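/- **Setting.** Consider a closed oriented polygonal mesh with finitely many vertices $j$, edges $e$ and cells $i$, each edge having two distinct end vertices and two distinct adjacent cells. Each cell contains a dual vertex (its centre), each vertex $j$ lies in a dual cell, and each edge $e$ meets its dual edge (joining the centres of the two adjacent cells) in a point $x_e$. The surface consists of the nondegenerate plane triangles in $\mathbb R^3$ with corners (vertex, $x_e$, cell centre); an $n$-gon, primal or dual, is made of $2n$ of them. Let $\mathbf k$ be the unit normal given by the orientation, $\mathbf u^\perp=\mathbf k\times\mathbf u$, and $\langle\cdot,\cdot\rangle$ the $L^2$ inner product on the surface. Each edge carries a unit normal $\mathbf n$ and tangent $\mathbf t=\mathbf k\times\mathbf n$. Let $n_{ei}=1$ ($-1$, $0$) if $\mathbf n$ points out of cell $i$ (into it, otherwise), $t_{ej}=1$ ($-1$, $0$) if $\mathbf t$ points towards vertex $j$ (away from it, otherwise), and $(D_2)_{ie}=n_{ei}$, $(D_1)_{ej}=t_{ej}$, $\overline D_1=-D_2^T$, $\overline D_2=D_1^T$. **Basis functions** (compound P1-RT0-P0 elements and their duals). $\alpha_i$ (resp. $\beta_j$) is constant on cell $i$ (resp. dual cell $j$)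 with integral $1$, and zero elsewhere. $\gamma_j$ is continuous and piecewise linear on the triangles, equal to $1$ at vertex $j$ and $0$ at the other vertices, linear in arc length along each edge, and discretely harmonic in each cell ($\langle\nabla\lambda,\nabla\gamma_j\rangle=0$, where $\lambda$ is the piecewise linear function equal to $1$ at the cell centre and $0$ on the cell boundary). $\mathbf v_e$ is a lowest-order Raviart–Thomas field on the triangles with continuous normal component; its normal component is constant along each edge, with flux $1$ through $e$ in the direction $\mathbf n$ and $0$ through the other edges; its divergence is constant on each cell; and it is weakly curl-free on each cell, $\langle\nabla^\perp\lambda,\mathbf v_e\rangle=0$. $\mathbf w_e=\mathbf k\times\mathbf r_e$, where $\mathbf r_e$ is the field constructed in the same way on the dual mesh, normalised so that $\mathbf w_e$ has circulation $1$ along the dual edge of $e$, in the sense of $\mathbf n$, and $0$ along the other dual edges. **Matrices.** $L_{ii'}=\langle\alpha_i,\alpha_{i'}\rangle$, $M_{ee'}=\langle\mathbf v_e,\mathbf v_{e'}\rangle$, $N_{jj'}=\langle\gamma_j,\gamma_{j'}\rangle$, $R_{ji}=\langle\gamma_j,\alpha_i\rangle$, $W_{ee'}=-\langle\mathbf v_e,\mathbf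 v_{e'}^\perp\rangle$, $H_{ee'}=\langle\mathbf v_e,\mathbf w_{e'}\rangle$, $J_{jj'}=\langle\gamma_j,\beta_{j'}\rangle$. Assume that $J$ is invertible. **Scheme.** Let $\mathrm{adv}_1,\mathrm{adv}_2$ be arbitrary maps (the advection operators), and let $\Phi_{\rm orog}$ (in the basis $\alpha_i$) and the Coriolis field $f=\sum_j f_j\beta_j$ be independent of time. Suppose that on a set $I$ of times (typically an interval; derivatives are taken within $I$) the coefficient vectors satisfy $$\dot\Phi+D_2F=0,\qquad M\dot U+MQ^\perp+\overline D_1L(\Phi+\Phi_{\rm orog}+K)=0,$$ with $K_i=\tfrac12\int_{\mathrm{cell}\ i}|\mathbf u|^2dA$, $\mathbf u=\sum_eU_e\mathbf v_e$, $F=\mathrm{adv}_1(U,\Phi)$. Let the dual mass flux $\widehat{F^\perp}$ satisfy $H\widehat{F^\perp}=-WF$, let the dual mass field $\bar\phi=\sum_j\bar\Phi_j\beta_j$ be given by $J\bar\Phi=R\Phi$, and let the vorticity be given by $N\Xi=\overline D_2MU$, $J\hat\Xi=N\Xi$, $\hat\xi=\sum_j\hat\Xi_j\beta_j$. Let the potential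 vorticity $\pi=\sum_j\Pi_j\beta_j$ satisfy $\pi\bar\phi=f+\hat\xi$ (that is, $\pi=(f+\hat\xi)/\bar\phi$ where $\bar\phi\neq0$), and let $\widehat{Q^\perp}=\mathrm{adv}_2(\widehat{F^\perp},\Pi)$ and $H\widehat{Q^\perp}=MQ^\perp$. **Claim.** At all times in $I$, $\bar\Phi$ and $\hat\Xi$ are differentiable and $$\dot{\bar\Phi}+\overline D_2\widehat{F^\perp}=0,\qquad \dot{\hat\Xi}+\overline D_2\widehat{Q^\perp}=0 .$$ Consequently dual mass and PV obey consistent finite-volume equations on the dual mesh: for every dual cell $j$, $$\frac{d}{dt}\int_{\text{dual cell }j}\bar\phi\,dA=-\sum_et_{ej}\,\widehat{F^\perp}_e,\qquad \frac{d}{dt}\int_{\text{dual cell }j}\pi\bar\phi\,dA=-\sum_et_{ej}\,\mathrm{adv}_2(\widehat{F^\perp},\Pi)_e .$$ -/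

import Mathlib

open MeasureTheory
open scoped Matrix

noncomputable section

/-! ### Closed polygonal meshes and their triangular supermesh -/

/-- A subtriangle `(e, h, l)` of the supermesh: its corners are the end `h` of the edge `e`
(`true` is the end that the unit tangent `t` points towards), the point where `e` meets its dual
edge, and the centre of the cell on side `l` of `e` (`true` is the left of `t`, that is, the side
from which the unit normal `n` points away, as `t = k × n`). -/
abbrev SubTri (E : Type*) := E × Bool × Bool

namespace SubTri

/-- The neighbour across the side opposite the primal vertex (same edge, same cell). -/
def flipVert {E : Type*} (T : SubTri E) : SubTri E := (T.1, !T.2.1, T.2.2)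

/-- The neighbour across the side opposite the cell centre (same edge, same vertex). -/
def flipCell {E : Type*} (T : SubTri E) : SubTri E := (T.1, T.2.1, !T.2.2)

end SubTri

/-- A closed oriented polygonal mesh with vertices `V`, edges `E` and cells `C`, together with its
dual mesh, realised as a surface made of planar triangular facets in `ℝ³`.  The cell `i` has the
dual vertex `posC i` as its centre, and the edge `e` and its dual edge meet in `posE e`: the primal
edge is the broken line vertex - `posE e` - vertex and the dual edge is the broken line
centre - `posE e` - centre.  The involution `turn` sends a subtriangle to the one on the other side
of the segment that joins its primal vertex to its cell centre. -/
structure PolygonalMesh (V E C : Type*) where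
  vert : E → Bool → V
  cell : E → Bool → C
  turn : SubTri E → SubTri E
  turn_turn : ∀ T, turn (turn T) = T
  vert_turn : ∀ T, vert (turn T).1 (turn T).2.1 = vert T.1 T.2.1
  cell_turn : ∀ T, cell (turn T).1 (turn T).2.2 = cell T.1 T.2.2
  /-- crossing a side reverses the cyclic order of (vertex, edge point, centre): orientability -/
  orient_turn : ∀ T, xor (turn T).2.1 (turn T).2.2 = !(xor T.2.1 T.2.2)
  vert_ne : ∀ e, vert e true ≠ vert e false
  cell_ne : ∀ e, cell e true ≠ cell e false
  vert_surj : ∀ j, ∃ e h, vert e h = j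
  cell_surj : ∀ i, ∃ e l, cell e l = i
  /-- the subtriangles of a primal cell form one cycle around its centre -/
  cell_cycle : ∀ T T' : SubTri E, cell T.1 T.2.2 = cell T'.1 T'.2.2 →
    Relation.EqvGen (fun S S' => S' = S.flipVert ∨ S' = turn S) T T'
  /-- the subtriangles around a primal vertex form one cycle, the dual cell -/
  vert_cycle : ∀ T T' : SubTri E, vert T.1 T.2.1 = vert T'.1 T'.2.1 →
    Relation.EqvGen (fun S S' => S' = turn S ∨ S' = S.flipCell) T T'
  posV : V → Fin 3 → ℝ
  posE : E → Fin 3 → ℝ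
  posC : C → Fin 3 → ℝ
  nondeg : ∀ T : SubTri E, (posE T.1 - posV (vert T.1 T.2.1)) ⨯₃
    (posC (cell T.1 T.2.2) - posV (vert T.1 T.2.1)) ≠ 0

/-- Euclidean length of a vector of `ℝ³`. -/
def len3 (u : Fin 3 → ℝ) : ℝ := √(u ⬝ᵥ u)

/-- The sign `1` for `true` and `-1` for `false`. -/
def bsign (b : Bool) : ℝ := if b then 1 else -1

/-- The reference triangle, which parametrises every facet affinely. -/
def refTri : Set (ℝ × ℝ) := {p | 0 ≤ p.1 ∧ 0 ≤ p.2 ∧ p.1 + p.2 ≤ 1}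

/-- Barycentric coordinates of a point of the reference triangle. -/
def bary (p : ℝ × ℝ) : Fin 3 → ℝ := ![1 - p.1 - p.2, p.1, p.2]

namespace PolygonalMesh

variable {V E C : Type*} (m : PolygonalMesh V E C)

/-! ### Geometry of the facets -/

/-- The primal vertex of a subtriangle, which labels its dual cell. -/
def vertOf (T : SubTri E) : V := m.vert T.1 T.2.1

/-- The primal cell of a subtriangle. -/
def cellOf (T : SubTri E) : C := m.cell T.1 T.2.2

/-- The corners of a subtriangle: 0 is the primal vertex, 1 the edge point, 2 the cell centre. -/
def corner (T : SubTri E) : Fin 3 → Fin 3 → ℝ :=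
  ![m.posV (m.vertOf T), m.posE T.1, m.posC (m.cellOf T)]

/-- The neighbour of a subtriangle across the side opposite corner `k`. -/
def adj (k : Fin 3) (T : SubTri E) : SubTri E := ![T.flipVert, m.turn T, T.flipCell] k

/-- A (non-unit) normal of a facet. -/
def nvec (T : SubTri E) : Fin 3 → ℝ :=
  (m.corner T 1 - m.corner T 0) ⨯₃ (m.corner T 2 - m.corner T 0)

/-- The area of a facet. -/
def area (T : SubTri E) : ℝ := len3 (m.nvec T) / 2

/-- `1` if (vertex, edge point, centre) is the counterclockwise order of the corners,
`-1` otherwise. -/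
def orient (T : SubTri E) : ℝ := if xor T.2.1 T.2.2 then 1 else -1

/-- The unit normal `k` of a facet, on the side from which the orientation is counterclockwise. -/
def kvec (T : SubTri E) : Fin 3 → ℝ := (orient T / len3 (m.nvec T)) • m.nvec T

/-- `u ↦ k × u` on a facet. -/
def perp (T : SubTri E) (u : Fin 3 → ℝ) : Fin 3 → ℝ := m.kvec T ⨯₃ u

/-- The point of a facet with given reference coordinates. -/
def pt (T : SubTri E) (p : ℝ × ℝ) : Fin 3 → ℝ := ∑ k, bary p k • m.corner T k

/-- The integral `∫ f dA` over one facet, by the affine parametrisation. -/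
def facetInt (T : SubTri E) (f : ℝ × ℝ → ℝ) : ℝ := 2 * m.area T * ∫ p in refTri, f p

/-- The integral over the part of the surface made of the facets in `S`. -/
def intOver (S : Finset (SubTri E)) (f : SubTri E → ℝ × ℝ → ℝ) : ℝ := ∑ T ∈ S, m.facetInt T (f T)

/-- The facets that make up a primal cell. -/
def cellTris [Fintype E] [DecidableEq C] (i : C) : Finset (SubTri E) := {T | m.cellOf T = i}

/-- The facets that make up a dual cell. -/
def dualTris [Fintype E] [DecidableEq V] (j : V) : Finset (SubTri E) := {T | m.vertOf T = j}

/-! ### Lowest order finite elements on the facets -/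

/-- The continuous piecewise linear function with corner values `g`. -/
def p1 (g : SubTri E → Fin 3 → ℝ) (T : SubTri E) (p : ℝ × ℝ) : ℝ := ∑ k, bary p k * g T k

/-- The surface gradient of the barycentric coordinate of corner `k`. -/
def gradBary (T : SubTri E) (k : Fin 3) : Fin 3 → ℝ :=
  (len3 (m.nvec T) ^ 2)⁻¹ • (m.nvec T ⨯₃ (m.corner T (k + 2) - m.corner T (k + 1)))

/-- The surface gradient of `p1 g` on a facet. -/
def gradP1 (g : SubTri E → Fin 3 → ℝ) (T : SubTri E) : Fin 3 → ℝ := ∑ k, g T k • m.gradBary T k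

/-- The lowest order Raviart-Thomas field whose flux out of the facet `T` through the side
opposite corner `k` is `f T k`. -/
def rt0 (f : SubTri E → Fin 3 → ℝ) (T : SubTri E) (p : ℝ × ℝ) : Fin 3 → ℝ :=
  ∑ k, (f T k / (2 * m.area T)) • (m.pt T p - m.corner T k)

/-- The divergence of `rt0 f` on a facet. -/
def divRT0 (f : SubTri E → Fin 3 → ℝ) (T : SubTri E) : ℝ := (∑ k, f T k) / m.area T

/-- Discrete harmonic extension of normal fluxes into compound elements.  The subtriangles are
grouped by `elem` into compound elements whose centre is corner `o`; `b` prescribes the fluxes out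
of the compound elements.  The field is Raviart-Thomas on the supermesh with continuous normal
component, its divergence is constant on each compound element, and its curl vanishes weakly: it is
orthogonal to `k × ∇` of the piecewise linear function that is 1 at the centre and vanishes on the
boundary of the element. -/
structure IsCompoundRT0 [Fintype E] {κ : Type*} [DecidableEq κ] (o : Fin 3)
    (elem : SubTri E → κ) (b : SubTri E → ℝ) (f : SubTri E → Fin 3 → ℝ) : Prop where
  normal_cont : ∀ k T, f (m.adj k T) k = -f T k
  boundary : ∀ T, f T o = b T
  div_const : ∀ T T', elem T = elem T' → m.divRT0 f T = m.divRT0 f T'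
  weak_curl : ∀ i, m.intOver {T | elem T = i}
    (fun T p => m.perp T (m.gradBary T o) ⬝ᵥ m.rt0 f T p) = 0

/-- Length of the half of the primal edge `e` that ends at its end `h`. -/
def halfP (e : E) (h : Bool) : ℝ := len3 (m.posV (m.vert e h) - m.posE e)

/-- Length of the half of the dual edge of `e` that ends at the centre on side `l`. -/
def halfD (e : E) (l : Bool) : ℝ := len3 (m.posC (m.cell e l) - m.posE e)

/-- Boundary fluxes of the velocity basis function of `e`: flux 1 through `e` along `n`, that is,
out of the left cell, with constant normal component along `e`; flux 0 through other edges. -/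
def vFlux [DecidableEq E] (e : E) (T : SubTri E) : ℝ :=
  if T.1 = e then bsign T.2.2 * (m.halfP e T.2.1 / (m.halfP e true + m.halfP e false)) else 0

/-- Boundary fluxes of the field `r` such that `k × r` is the dual basis function of `e`: the
circulation of `k × r` along the dual edge, from the left to the right of `e`, is 1, that is, `r`
has flux 1 out of the dual cell of the vertex that `t` points towards. -/
def wFlux [DecidableEq E] (e : E) (T : SubTri E) : ℝ :=
  if T.1 = e then bsign T.2.1 * (m.halfD e T.2.2 / (m.halfD e true + m.halfD e false)) else 0

/-- Corner values of a piecewise linear function that is 1 at the vertex `j`, 0 at other vertices,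
linear in arc length along the primal edges, and has the value `c i` at the centre of cell `i`. -/
def hatVals [DecidableEq V] (j : V) (c : C → ℝ) (T : SubTri E) : Fin 3 → ℝ :=
  ![if m.vertOf T = j then 1 else 0,
    ∑ h : Bool, (if m.vert T.1 h = j then
      m.halfP T.1 (!h) / (m.halfP T.1 true + m.halfP T.1 false) else 0),
    c (m.cellOf T)]

/-! ### Existence of the compound basis functions -/

theorem exists_flow {F κ : Type*} [Fintype F] [DecidableEq κ] (a b : F → F)
    (elem : F → κ)
    (hab : ∀ T T', elem T = elem T' → Relation.EqvGen (fun S S' => S' = a S ∨ S' = b S) T T')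
    (ha : ∀ T, a (a T) = T) (hb : ∀ T, b (b T) = T)
    (g : F → ℝ) (hg : ∀ i, ∑ T with elem T = i, g T = 0) :
    ∃ x y : F → ℝ, (∀ T, x (a T) = -x T) ∧ (∀ T, y (b T) = -y T) ∧ ∀ T, x T + y T = g T := by
  classical
  let A : ((F → ℝ) × (F → ℝ)) →ₗ[ℝ] (F → ℝ) :=
    { toFun := fun z T => (z.1 T - z.1 (a T)) + (z.2 T - z.2 (b T))
      map_add' := by intro z w; ext T; simp; ring
      map_smul' := by intro c z; ext T; simp; ring }
  by_cases hgA : g ∈ LinearMap.range A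
  · obtain ⟨⟨z, w⟩, h⟩ := hgA
    refine ⟨fun T => z T - z (a T), fun T => w T - w (b T), fun T => ?_, fun T => ?_, fun T => ?_⟩
    · simp [ha]
    · simp [hb]
    · exact congrFun h T
  exfalso
  obtain ⟨φ, hφ, hle⟩ := Submodule.exists_le_ker_of_notMem hgA
  have key : ∀ z w : F → ℝ, φ (fun T => (z T - z (a T)) + (w T - w (b T))) = 0 :=
    fun z w => hle ⟨(z, w), rfl⟩
  have hrep : ∀ v : F → ℝ, φ v = ∑ T, v T * φ (Pi.single T 1) := by
    intro v
    rw [LinearMap.pi_apply_eq_sum_univ φ v]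
    refine Finset.sum_congr rfl fun T _ => ?_
    rw [smul_eq_mul]; congr 2; ext j; simp [Pi.single_apply, eq_comm]
  set h : F → ℝ := fun T => φ (Pi.single T 1) with hh
  have hsa : ∀ T, h (a T) = h T := by
    intro T
    have := key (Pi.single T 1) 0
    have e : (fun S => ((Pi.single T 1 : F → ℝ) S - (Pi.single T 1 : F → ℝ) (a S)) +
        ((0 : F → ℝ) S - (0 : F → ℝ) (b S))) = Pi.single T 1 - Pi.single (a T) 1 := by
      ext S
      have : a S = T ↔ S = a T := ⟨fun h => by rw [← h, ha], fun h => by rw [h, ha]⟩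
      simp [Pi.single_apply, this]
    rw [e, map_sub] at this
    simp only [hh]; linarith
  have hsb : ∀ T, h (b T) = h T := by
    intro T
    have := key 0 (Pi.single T 1)
    have e : (fun S => ((0 : F → ℝ) S - (0 : F → ℝ) (a S)) +
        ((Pi.single T 1 : F → ℝ) S - (Pi.single T 1 : F → ℝ) (b S))) =
        Pi.single T 1 - Pi.single (b T) 1 := by
      ext S
      have : b S = T ↔ S = b T := ⟨fun h => by rw [← h, hb], fun h => by rw [h, hb]⟩
      simp [Pi.single_apply, this]
    rw [e, map_sub] at this
    simp only [hh]; linarith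
  have hconst : ∀ T T', elem T = elem T' → h T = h T' := by
    intro T T' he
    have gen : ∀ S S', Relation.EqvGen (fun S S' => S' = a S ∨ S' = b S) S S' → h S = h S' := by
      intro S S' hS
      induction hS with
      | rel x y hxy => rcases hxy with rfl | rfl <;> simp [hsa, hsb]
      | refl x => rfl
      | symm x y _ ih => exact ih.symm
      | trans x y z _ _ ih1 ih2 => exact ih1.trans ih2
    exact gen T T' (hab T T' he)
  apply hφ
  rw [hrep g]
  rw [← Finset.sum_fiberwise_of_maps_to (s := Finset.univ) (t := Finset.univ.image elem) (g := elem)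
    (fun T _ => Finset.mem_image_of_mem _ (Finset.mem_univ T))]
  refine Finset.sum_eq_zero fun i hi => ?_
  obtain ⟨T0, -, hT0⟩ := Finset.mem_image.1 hi
  rw [Finset.sum_congr rfl (g := fun T => g T * h T0), ← Finset.sum_mul, hg, zero_mul]
  intro T hT
  show g T * h T = g T * h T0
  rw [hconst T T0]
  rw [(Finset.mem_filter.1 hT).2, hT0]

theorem flipVert_flipVert (T : SubTri E) : T.flipVert.flipVert = T := by
  simp [SubTri.flipVert]

theorem flipCell_flipCell (T : SubTri E) : T.flipCell.flipCell = T := by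
  simp [SubTri.flipCell]

theorem adj_adj (k : Fin 3) (T : SubTri E) : m.adj k (m.adj k T) = T := by
  fin_cases k
  · exact flipVert_flipVert T
  · exact m.turn_turn T
  · exact flipCell_flipCell T

theorem orient_adj (k : Fin 3) (T : SubTri E) : orient (m.adj k T) = -orient T := by
  have h1 := m.orient_turn T
  rcases T with ⟨e, h, l⟩
  fin_cases k
  · cases h <;> cases l <;> simp [adj, orient, SubTri.flipVert]
  · show orient (m.turn (e, h, l)) = _
    unfold orient
    rw [h1]
    cases h <;> cases l <;> simp
  · cases h <;> cases l <;> simp [adj, orient, SubTri.flipCell]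

theorem orient_mul_self (T : SubTri E) : orient T * orient T = 1 := by
  unfold orient; split_ifs <;> norm_num

theorem dot_self_nonneg (u : Fin 3 → ℝ) : 0 ≤ u ⬝ᵥ u :=
  Finset.sum_nonneg fun i _ => mul_self_nonneg (u i)

theorem len3_sq (u : Fin 3 → ℝ) : len3 u ^ 2 = u ⬝ᵥ u := Real.sq_sqrt (dot_self_nonneg u)

theorem len3_pos {u : Fin 3 → ℝ} (hu : u ≠ 0) : 0 < len3 u :=
  Real.sqrt_pos.2 ((dot_self_nonneg u).lt_of_ne fun h => hu (dotProduct_self_eq_zero.1 h.symm))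

theorem nvec_ne (T : SubTri E) : m.nvec T ≠ 0 := m.nondeg T

theorem area_pos (T : SubTri E) : 0 < m.area T := half_pos (len3_pos (m.nvec_ne T))

/-- The side opposite corner `o`. -/
def side (T : SubTri E) (o : Fin 3) : Fin 3 → ℝ := m.corner T (o + 2) - m.corner T (o + 1)

theorem nvec_dot_side (T : SubTri E) (o : Fin 3) : m.nvec T ⬝ᵥ m.side T o = 0 := by
  fin_cases o <;> simp [side, nvec, cross_apply, dotProduct, Fin.sum_univ_three] <;> ring

theorem side_ne (T : SubTri E) (o : Fin 3) : m.side T o ≠ 0 := by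
  intro h
  apply m.nvec_ne T
  fin_cases o
  · have h' : m.corner T 2 = m.corner T 1 := sub_eq_zero.1 h
    simp [nvec, h']
  · have h' : m.corner T 0 = m.corner T 2 := sub_eq_zero.1 h
    simp [nvec, h']
  · have h' : m.corner T 1 = m.corner T 0 := sub_eq_zero.1 h
    simp [nvec, h']

theorem side_dot_pos (T : SubTri E) (o : Fin 3) : 0 < m.side T o ⬝ᵥ m.side T o :=
  (dot_self_nonneg _).lt_of_ne fun h => m.side_ne T o (dotProduct_self_eq_zero.1 h.symm)

theorem perp_gradBary (T : SubTri E) (o : Fin 3) :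
    m.perp T (m.gradBary T o) = (-(orient T / len3 (m.nvec T))) • m.side T o := by
  have hl := (len3_pos (m.nvec_ne T)).ne'
  have h1 := m.nvec_dot_side T o
  have h2 := len3_sq (m.nvec T)
  unfold perp kvec gradBary
  change ((orient T / len3 (m.nvec T)) • m.nvec T) ⨯₃
    ((len3 (m.nvec T) ^ 2)⁻¹ • (m.nvec T ⨯₃ m.side T o)) = _
  rw [map_smul, map_smul, LinearMap.smul_apply, cross_cross_eq_smul_sub_smul', h1, ← h2, zero_smul,
    zero_sub]
  ext i
  simp only [Pi.smul_apply, Pi.neg_apply, smul_eq_mul]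
  field_simp

theorem isCompact_refTri : IsCompact refTri := by
  apply Metric.isCompact_of_isClosed_isBounded
  · exact (isClosed_le continuous_const continuous_fst).inter
      ((isClosed_le continuous_const continuous_snd).inter
        (isClosed_le (continuous_fst.add continuous_snd) continuous_const))
  · refine (Metric.isBounded_Icc (0 : ℝ × ℝ) (1, 1)).subset ?_
    rintro ⟨x, y⟩ ⟨h1, h2, h3⟩
    simp only at h1 h2 h3
    exact ⟨⟨h1, h2⟩, ⟨by linarith, by linarith⟩⟩

theorem refTri_pos : 0 < (volume refTri).toReal := by
  apply ENNReal.toReal_pos _ isCompact_refTri.measure_lt_top.ne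
  have hU : IsOpen {p : ℝ × ℝ | 0 < p.1 ∧ 0 < p.2 ∧ p.1 + p.2 < 1} :=
    (isOpen_lt continuous_const continuous_fst).inter
      ((isOpen_lt continuous_const continuous_snd).inter
        (isOpen_lt (continuous_fst.add continuous_snd) continuous_const))
  have hmem : ((1 / 4 : ℝ), (1 / 4 : ℝ)) ∈ {p : ℝ × ℝ | 0 < p.1 ∧ 0 < p.2 ∧ p.1 + p.2 < 1} := by
    refine ⟨?_, ?_, ?_⟩ <;> norm_num
  have hpos := hU.measure_pos (volume : Measure (ℝ × ℝ)) ⟨_, hmem⟩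
  have hsub : {p : ℝ × ℝ | 0 < p.1 ∧ 0 < p.2 ∧ p.1 + p.2 < 1} ⊆ refTri :=
    fun p (hp : 0 < p.1 ∧ 0 < p.2 ∧ p.1 + p.2 < 1) =>
      (⟨hp.1.le, hp.2.1.le, hp.2.2.le⟩ : 0 ≤ p.1 ∧ 0 ≤ p.2 ∧ p.1 + p.2 ≤ 1)
  exact (hpos.trans_le (measure_mono hsub)).ne'

theorem continuous_rt0_dot (a : Fin 3 → ℝ) (f : SubTri E → Fin 3 → ℝ) (T : SubTri E) :
    Continuous fun p => a ⬝ᵥ m.rt0 f T p := by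
  have h : ∀ k, Continuous fun p => bary p k := by
    intro k; fin_cases k <;> simp [bary] <;> fun_prop
  have h' : ∀ i, Continuous fun p => m.rt0 f T p i := by
    intro i
    simp only [rt0, pt, Finset.sum_apply, Pi.smul_apply, Pi.sub_apply, smul_eq_mul]
    fun_prop
  unfold dotProduct
  fun_prop

theorem exists_isCompoundRT0 [Fintype E] {κ : Type*} [DecidableEq κ] (o : Fin 3)
    (elem : SubTri E → κ) (b : SubTri E → ℝ)
    (h1 : ∀ T, elem (m.adj (o + 1) T) = elem T) (h2 : ∀ T, elem (m.adj (o + 2) T) = elem T)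
    (hab : ∀ T T', elem T = elem T' →
      Relation.EqvGen (fun S S' => S' = m.adj (o + 1) S ∨ S' = m.adj (o + 2) S) T T')
    (hb : ∀ T, b (m.adj o T) = -b T) : ∃ f, m.IsCompoundRT0 o elem b f := by
  classical
  let S : κ → Finset (SubTri E) := fun i => {T | elem T = i}
  let c : κ → ℝ := fun i => (∑ T ∈ S i, b T) / ∑ T ∈ S i, m.area T
  have hA : ∀ T, 0 < ∑ T' ∈ S (elem T), m.area T' := fun T =>
    Finset.sum_pos (fun T' _ => m.area_pos T') ⟨T, by simp [S]⟩
  obtain ⟨x, y, hx, hy, hxy⟩ := exists_flow (m.adj (o + 1)) (m.adj (o + 2)) elem hab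
    (m.adj_adj _) (m.adj_adj _) (fun T => c (elem T) * m.area T - b T) (by
      intro i
      by_cases hi : ∃ T, elem T = i
      · obtain ⟨T, rfl⟩ := hi
        rw [Finset.sum_sub_distrib, Finset.sum_congr rfl (g := fun T' => c (elem T) * m.area T'),
          ← Finset.mul_sum]
        · show (∑ T ∈ S (elem T), b T) / (∑ T' ∈ S (elem T), m.area T') *
            (∑ T' ∈ S (elem T), m.area T') - ∑ T ∈ S (elem T), b T = 0
          rw [div_mul_cancel₀ _ (hA T).ne', sub_self]
        · intro T' hT'
          rw [(Finset.mem_filter.1 hT').2]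
      · apply Finset.sum_eq_zero
        intro T hT
        exact absurd ⟨T, (Finset.mem_filter.1 hT).2⟩ hi)
  -- the flux field, up to a circulation `z` around each centre
  let f : (κ → ℝ) → SubTri E → Fin 3 → ℝ := fun z T k =>
    if k = o then b T else if k = o + 1 then x T + z (elem T) * orient T
      else y T - z (elem T) * orient T
  have ho1 : o + 1 ≠ o := by fin_cases o <;> decide
  have ho2 : o + 2 ≠ o := by fin_cases o <;> decide
  have ho3 : o + 2 ≠ o + 1 := by fin_cases o <;> decide
  have hcases : ∀ k : Fin 3, k = o ∨ k = o + 1 ∨ k = o + 2 := by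
    intro k; fin_cases o <;> fin_cases k <;> decide
  have hsum : ∀ u : Fin 3 → ℝ, ∑ k, u k = u o + u (o + 1) + u (o + 2) := by
    intro u; rw [Fin.sum_univ_three]; fin_cases o <;> simp <;> ring
  have hsumv : ∀ u : Fin 3 → Fin 3 → ℝ, ∑ k, u k = u o + u (o + 1) + u (o + 2) := by
    intro u; rw [Fin.sum_univ_three]; fin_cases o <;> simp <;> abel
  have hrt : ∀ z T p, m.rt0 (f z) T p = m.rt0 (f 0) T p +
      (z (elem T) * orient T / (2 * m.area T)) • m.side T o := by
    intro z T p
    unfold rt0 side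
    rw [hsumv, hsumv]
    simp only [f, if_true, ho1, ho2, ho3, if_false, Pi.zero_apply, zero_mul, add_zero, sub_zero]
    ext i
    simp only [Pi.add_apply, Pi.smul_apply, Pi.sub_apply, smul_eq_mul]
    ring
  let I0 : κ → ℝ := fun i => m.intOver (S i) fun T p =>
    m.perp T (m.gradBary T o) ⬝ᵥ m.rt0 (f 0) T p
  let I1 : κ → ℝ := fun i => ∑ T ∈ S i, (m.side T o ⬝ᵥ m.side T o) / len3 (m.nvec T) *
    (volume refTri).toReal
  have hint : ∀ z i, m.intOver (S i) (fun T p => m.perp T (m.gradBary T o) ⬝ᵥ m.rt0 (f z) T p) =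
      I0 i - z i * I1 i := by
    intro z i
    simp only [I0, I1, intOver]
    rw [Finset.mul_sum, ← Finset.sum_sub_distrib]
    refine Finset.sum_congr rfl fun T hT => ?_
    have hTi : elem T = i := (Finset.mem_filter.1 hT).2
    have hl := len3_pos (m.nvec_ne T)
    have e1 : ∀ p, m.perp T (m.gradBary T o) ⬝ᵥ m.rt0 (f z) T p =
        m.perp T (m.gradBary T o) ⬝ᵥ m.rt0 (f 0) T p -
          z i * (m.side T o ⬝ᵥ m.side T o) / len3 (m.nvec T) ^ 2 := by
      intro p
      rw [hrt z T p, dotProduct_add, perp_gradBary, hTi, smul_dotProduct, smul_dotProduct,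
        dotProduct_smul]
      have e3 : 2 * m.area T = len3 (m.nvec T) := by unfold area; ring
      have e4 := orient_mul_self T
      rw [e3]
      simp only [smul_eq_mul]
      field_simp
      linear_combination (-(z i * (m.side T o ⬝ᵥ m.side T o))) * e4
    unfold facetInt
    simp only [e1]
    rw [integral_sub
      ((m.continuous_rt0_dot _ _ T).continuousOn.integrableOn_compact isCompact_refTri)
      (continuous_const.continuousOn.integrableOn_compact isCompact_refTri), setIntegral_const]
    have e3 : 2 * m.area T = len3 (m.nvec T) := by unfold area; ring
    rw [e3, smul_eq_mul]
    simp only [Measure.real]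
    field_simp
  have hI1 : ∀ T, 0 < I1 (elem T) := fun T =>
    Finset.sum_pos (fun T' _ => mul_pos (div_pos (m.side_dot_pos T' o)
      (len3_pos (m.nvec_ne T'))) refTri_pos) ⟨T, by simp [S]⟩
  refine ⟨f (fun i => I0 i / I1 i), ?_, ?_, ?_, ?_⟩
  · intro k T
    rcases hcases k with rfl | rfl | rfl
    · simp [f, hb]
    · simp only [f, if_true, ho1, if_false, hx, h1, orient_adj]; ring
    · simp only [f, ho2, ho3, if_false, hy, h2, orient_adj]; ring
  · intro T; simp [f]
  · have hd : ∀ z T, m.divRT0 (f z) T = c (elem T) := by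
      intro z T
      unfold divRT0
      rw [hsum, div_eq_iff (m.area_pos T).ne']
      simp only [f, if_true, ho1, ho2, ho3, if_false]
      linear_combination hxy T
    intro T T' h
    exact (hd (fun i => I0 i / I1 i) T).trans
      ((congrArg c h).trans (hd (fun i => I0 i / I1 i) T').symm)
  · intro i
    refine (hint (fun i => I0 i / I1 i) i).trans ?_
    show I0 i - I0 i / I1 i * I1 i = 0
    by_cases hi : ∃ T, elem T = i
    · obtain ⟨T, rfl⟩ := hi
      rw [div_mul_cancel₀ _ (hI1 T).ne', sub_self]
    · have : S i = ∅ := by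
        apply Finset.filter_eq_empty_iff.2
        intro T _ hT
        exact hi ⟨T, hT⟩
      simp [I0, I1, intOver, this]

theorem vOf_turn (T : SubTri E) : m.vertOf (m.turn T) = m.vertOf T := m.vert_turn T
theorem cOf_turn (T : SubTri E) : m.cellOf (m.turn T) = m.cellOf T := m.cell_turn T

theorem exists_primal_rt0 [Fintype E] [DecidableEq E] [DecidableEq C] (e : E) :
    ∃ f, m.IsCompoundRT0 2 m.cellOf (m.vFlux e) f := by
  refine m.exists_isCompoundRT0 2 m.cellOf (m.vFlux e) (fun T => rfl) m.cOf_turn m.cell_cycle ?_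
  rintro ⟨e', h, l⟩
  show m.vFlux e (e', h, !l) = - m.vFlux e (e', h, l)
  unfold vFlux
  cases l <;> simp [bsign] <;> split_ifs <;> simp

theorem exists_dual_rt0 [Fintype E] [DecidableEq E] [DecidableEq V] (e : E) :
    ∃ f, m.IsCompoundRT0 0 m.vertOf (m.wFlux e) f := by
  refine m.exists_isCompoundRT0 0 m.vertOf (m.wFlux e) m.vOf_turn (fun T => rfl) m.vert_cycle ?_
  rintro ⟨e', h, l⟩
  show m.wFlux e (e', !h, l) = - m.wFlux e (e', h, l)
  unfold wFlux
  cases h <;> simp [bsign] <;> split_ifs <;> simp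

/-- Discrete harmonicity at the cell centres: on every cell, the gradient of the function is
orthogonal to the gradient of the piecewise linear function that is 1 at the centre and vanishes on
the boundary of the cell. -/
def IsDiscreteHarmonic [Fintype E] [DecidableEq C] (g : SubTri E → Fin 3 → ℝ) : Prop :=
  ∀ i, m.intOver (m.cellTris i) (fun T _ => m.gradBary T 2 ⬝ᵥ m.gradP1 g T) = 0

theorem gradBary_ne (T : SubTri E) (k : Fin 3) : m.gradBary T k ≠ 0 := by
  intro h
  have h1 := m.perp_gradBary T k
  have hl := len3_pos (m.nvec_ne T)
  have ho : orient T ≠ 0 := fun h0 => by simpa [h0] using orient_mul_self T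
  rw [h, perp, map_zero] at h1
  rcases smul_eq_zero.1 h1.symm with h2 | h2
  · exact div_ne_zero ho hl.ne' (neg_eq_zero.1 h2)
  · exact m.side_ne T k h2

theorem exists_hat [Fintype E] [DecidableEq V] [DecidableEq C] (j : V) :
    ∃ c : C → ℝ, m.IsDiscreteHarmonic (m.hatVals j c) := by
  classical
  let w : SubTri E → ℝ := fun T => 2 * m.area T * (volume refTri).toReal
  have hw : ∀ T, 0 < w T := fun T => mul_pos (mul_pos two_pos (m.area_pos T)) refTri_pos
  let N : C → ℝ := fun i => ∑ T ∈ m.cellTris i,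
    w T * (m.gradBary T 2 ⬝ᵥ m.gradP1 (m.hatVals j 0) T)
  let D : C → ℝ := fun i => ∑ T ∈ m.cellTris i, w T * (m.gradBary T 2 ⬝ᵥ m.gradBary T 2)
  have hD : ∀ i, 0 < D i := by
    intro i
    obtain ⟨e, l, h⟩ := m.cell_surj i
    refine Finset.sum_pos (fun T _ => mul_pos (hw T) ((dot_self_nonneg _).lt_of_ne fun h0 =>
      m.gradBary_ne T 2 (dotProduct_self_eq_zero.1 h0.symm))) ⟨(e, true, l), ?_⟩
    exact Finset.mem_filter.2 ⟨Finset.mem_univ _, h⟩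
  refine ⟨fun i => -(N i / D i), fun i => ?_⟩
  have key : m.intOver (m.cellTris i) (fun T _ => m.gradBary T 2 ⬝ᵥ
      m.gradP1 (m.hatVals j fun i => -(N i / D i)) T) = N i + -(N i / D i) * D i := by
    simp only [N, D, intOver]
    rw [Finset.mul_sum, ← Finset.sum_add_distrib]
    refine Finset.sum_congr rfl fun T hT => ?_
    have hTi : m.cellOf T = i := (Finset.mem_filter.1 hT).2
    have e1 : ∀ c : C → ℝ, m.gradP1 (m.hatVals j c) T =
        m.gradP1 (m.hatVals j 0) T + c (m.cellOf T) • m.gradBary T 2 := by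
      intro c
      simp [gradP1, Fin.sum_univ_three, hatVals]
    rw [e1, hTi, dotProduct_add, dotProduct_smul]
    unfold facetInt
    rw [setIntegral_const]
    simp only [w, smul_eq_mul, Measure.real]
    ring
  rw [key, neg_mul, div_mul_cancel₀ _ (hD i).ne', add_neg_cancel]

/-! ### Basis functions -/

section Basis

variable [Fintype V] [Fintype E] [Fintype C] [DecidableEq V] [DecidableEq E] [DecidableEq C]

/-- The basis function `α i` of `V₂`: constant on the cell `i` with integral 1, 0 elsewhere. -/
def alpha (i : C) (T : SubTri E) (_p : ℝ × ℝ) : ℝ :=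
  if m.cellOf T = i then (∑ S ∈ m.cellTris i, m.area S)⁻¹ else 0

/-- The basis function `β j` of `V²`: constant on the dual cell `j` with integral 1, 0 elsewhere. -/
def beta (j : V) (T : SubTri E) (_p : ℝ × ℝ) : ℝ :=
  if m.vertOf T = j then (∑ S ∈ m.dualTris j, m.area S)⁻¹ else 0

/-- The basis function `γ j` of `V₀`: the compound piecewise linear function that is 1 at the
vertex `j` and 0 at the other vertices. -/
def gamma (j : V) : SubTri E → ℝ × ℝ → ℝ := p1 (m.hatVals j (m.exists_hat j).choose)

/-- The basis function `v e` of `V₁`: the compound Raviart-Thomas field with flux 1 through `e`. -/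
def v (e : E) : SubTri E → ℝ × ℝ → Fin 3 → ℝ := m.rt0 (m.exists_primal_rt0 e).choose

/-- The basis function `w e` of `V¹`: `k ×` the compound Raviart-Thomas field of the dual mesh. -/
def w (e : E) (T : SubTri E) (p : ℝ × ℝ) : Fin 3 → ℝ :=
  m.perp T (m.rt0 (m.exists_dual_rt0 e).choose T p)

/-! ### Incidence matrices and mass matrices -/

/-- `n_{e i}`: `1` if the normal of `e` points out of the cell `i`, `-1` if it points into it. -/
def nInc (e : E) (i : C) : ℝ :=
  if m.cell e true = i then 1 else if m.cell e false = i then -1 else 0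

/-- `t_{e j}`: `1` if the tangent of `e` points towards the vertex `j`, `-1` if away from it. -/
def tInc (e : E) (j : V) : ℝ :=
  if m.vert e true = j then 1 else if m.vert e false = j then -1 else 0

def D2 : Matrix C E ℝ := .of fun i e => m.nInc e i
def D1 : Matrix E V ℝ := .of fun e j => m.tInc e j
def D1bar : Matrix E C ℝ := -m.D2ᵀ
def D2bar : Matrix V E ℝ := m.D1ᵀ

/-- The inner product `⟨f, g⟩` of scalar fields on the surface. -/
def innerS (f g : SubTri E → ℝ × ℝ → ℝ) : ℝ :=
  m.intOver Finset.univ fun T p => f T p * g T p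

/-- The inner product `⟨f, g⟩` of vector fields on the surface. -/
def innerV (f g : SubTri E → ℝ × ℝ → Fin 3 → ℝ) : ℝ :=
  m.intOver Finset.univ fun T p => f T p ⬝ᵥ g T p

def L : Matrix C C ℝ := .of fun i i' => m.innerS (m.alpha i) (m.alpha i')
def M : Matrix E E ℝ := .of fun e e' => m.innerV (m.v e) (m.v e')
def N : Matrix V V ℝ := .of fun j j' => m.innerS (m.gamma j) (m.gamma j')
def R : Matrix V C ℝ := .of fun j i => m.innerS (m.gamma j) (m.alpha i)
def W : Matrix E E ℝ := .of fun e e' => -m.innerV (m.v e) (fun T p => m.perp T (m.v e' T p))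
def H : Matrix E E ℝ := .of fun e e' => m.innerV (m.v e) (m.w e')
def J : Matrix V V ℝ := .of fun j j' => m.innerS (m.gamma j) (m.beta j')

/-- `T_{i e e'} = ∫_{cell i} v_e · v_{e'} dA`. -/
def kinT (i : C) (e e' : E) : ℝ :=
  m.intOver (m.cellTris i) fun T p => m.v e T p ⬝ᵥ m.v e' T p

/-- Coefficients of the kinetic energy per unit mass. -/
def kinetic (U : E → ℝ) (i : C) : ℝ := (∑ e, ∑ e', m.kinT i e e' * U e * U e') / 2

/-- The field of `V²` with coefficients `X`. -/
def dualField (X : V → ℝ) (T : SubTri E) (p : ℝ × ℝ) : ℝ := ∑ j, X j * m.beta j T p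

end Basis

end PolygonalMesh

/-! ### The nonlinear shallow water scheme -/

/-- The coefficient vectors of the scheme as functions of time. -/
structure SWTrajectory (V E C : Type*) where
  /-- geopotential in `V₂` -/
  Phi : ℝ → C → ℝ
  /-- velocity in `V₁` -/
  U : ℝ → E → ℝ
  /-- mass flux in `V₁` -/
  F : ℝ → E → ℝ
  /-- `F̂^⊥`, dual mass flux in `V¹` -/
  FhatPerp : ℝ → E → ℝ
  /-- `Q^⊥`, PV flux in `V₁` -/
  QPerp : ℝ → E → ℝ
  /-- `Q̂^⊥`, dual PV flux in `V¹` -/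
  QhatPerp : ℝ → E → ℝ
  /-- dual mass field in `V²` -/
  PhiBar : ℝ → V → ℝ
  /-- relative vorticity in `V₀` -/
  Xi : ℝ → V → ℝ
  /-- dual relative vorticity in `V²` -/
  XiHat : ℝ → V → ℝ
  /-- potential vorticity in `V²` -/
  PV : ℝ → V → ℝ

/-- The nonlinear scheme on the set of times `I`, with orography coefficients `PhiOrog` in `V₂`,
Coriolis coefficients `cor` in `V²`, and advection operators `adv1` on the primal mesh and `adv2` on
the dual mesh. -/
structure SWTrajectory.Solves {V E C : Type*} [Fintype V] [Fintype E] [Fintype C]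
    [DecidableEq V] [DecidableEq E] [DecidableEq C] (s : SWTrajectory V E C)
    (m : PolygonalMesh V E C) (adv1 : (E → ℝ) → (C → ℝ) → E → ℝ)
    (adv2 : (E → ℝ) → (V → ℝ) → E → ℝ) (PhiOrog : C → ℝ) (cor : V → ℝ) (I : Set ℝ) : Prop where
  /-- `dΦ/dt + D₂ F = 0` -/
  mass : ∀ t ∈ I, ∃ dPhi, HasDerivWithinAt s.Phi dPhi I t ∧ dPhi + m.D2 *ᵥ s.F t = 0
  /-- `M dU/dt + M Q^⊥ + D̄₁ L (Φ_T + K) = 0` with `Φ_T = Φ + Φ_orog` -/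
  momentum : ∀ t ∈ I, ∃ dU, HasDerivWithinAt s.U dU I t ∧
    m.M *ᵥ dU + m.M *ᵥ s.QPerp t +
      m.D1bar *ᵥ (m.L *ᵥ ((s.Phi t + PhiOrog) + m.kinetic (s.U t))) = 0
  massFlux : ∀ t ∈ I, s.F t = adv1 (s.U t) (s.Phi t)
  dualMassFlux : ∀ t ∈ I, m.H *ᵥ s.FhatPerp t = -(m.W *ᵥ s.F t)
  dualMass : ∀ t ∈ I, m.J *ᵥ s.PhiBar t = m.R *ᵥ s.Phi t
  vorticity : ∀ t ∈ I, m.N *ᵥ s.Xi t = m.D2bar *ᵥ (m.M *ᵥ s.U t)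
  dualVorticity : ∀ t ∈ I, m.J *ᵥ s.XiHat t = m.N *ᵥ s.Xi t
  /-- `π = (f + ξ̂) / φ̄`, in the form `π φ̄ = f + ξ̂`, pointwise on the surface -/
  pv : ∀ t ∈ I, ∀ T p, m.dualField (s.PV t) T p * m.dualField (s.PhiBar t) T p =
    m.dualField cor T p + m.dualField (s.XiHat t) T p
  pvFlux : ∀ t ∈ I, s.QhatPerp t = adv2 (s.FhatPerp t) (s.PV t)
  primalPVFlux : ∀ t ∈ I, m.H *ᵥ s.QhatPerp t = m.M *ᵥ s.QPerp t

end

/-! Everything follows from three matrix identities: `D2bar * H = J * D2bar`, `D2bar * W = -(R *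
D2)` and `D2bar * D1bar = 0`. With the first two, `J *ᵥ` the derivative of `PhiBar` is -R D₂ F = D̄₂
W F = -D̄₂ H F̂^⊥ = -J D̄₂ F̂^⊥, and `J` cancels. Applying `D2bar` to the momentum equation removes
the gradient term by the third identity and leaves D̄₂ M dU/dt = -D̄₂ H Q̂^⊥ = -J D̄₂ Q̂^⊥, which is
the vorticity equation up to `J`.

The third identity is combinatorial: at each corner of a cell two subtriangles meet, with opposite
orientations (`D2_mul_D1`).

The first two rest on `sum_tInc_smul_v`: ∑ t_{ej} v_e = -k × ∇γ_j. Both sides are compound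
Raviart-Thomas fields with the same boundary fluxes, and such fields are unique
(`IsCompoundRT0.eq_zero`). Pairing with k × f for a Raviart-Thomas field f and integrating by parts
(`innerV_gradP1_rt0`) gives ⟨γ_j, div f⟩. The choice f = v_e has div f = ∑ n_{ei} α_i and yields the
identity for `W`; the choice f = r_e has div f = ∑ t_{ej} β_j and yields the one for `H`. -/

namespace PolygonalMesh

variable {V E C : Type*} (m : PolygonalMesh V E C)

/-! ### Integrals over the reference triangle -/

theorem continuous_bary (k : Fin 3) : Continuous fun p => bary p k := by
  fin_cases k <;> simp [bary] <;> fun_prop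

theorem _root_.Continuous.integrableOn_refTri {f : ℝ × ℝ → ℝ} (hf : Continuous f) :
    IntegrableOn f refTri :=
  hf.continuousOn.integrableOn_compact isCompact_refTri

/-- Fubini: the slice of the triangle over x is [0, 1 - x] for x in [0, 1] and empty otherwise. -/
theorem setIntegral_refTri {f : ℝ × ℝ → ℝ} (hf : Continuous f) :
    ∫ p in refTri, f p = ∫ x in (0 : ℝ)..1, ∫ y in (0 : ℝ)..(1 - x), f (x, y) := by
  have hm : MeasurableSet refTri := isCompact_refTri.measurableSet
  have hi : Integrable (refTri.indicator f) (volume.prod volume) := by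
    rw [← Measure.volume_eq_prod]
    exact hf.integrableOn_refTri.integrable_indicator hm
  rw [← integral_indicator hm, Measure.volume_eq_prod, integral_prod _ hi,
    intervalIntegral.integral_of_le zero_le_one, ← integral_Icc_eq_integral_Ioc,
    ← integral_indicator measurableSet_Icc]
  refine integral_congr_ae (.of_forall fun x => ?_)
  by_cases hx : x ∈ Set.Icc (0 : ℝ) 1
  · rw [Set.indicator_of_mem hx, intervalIntegral.integral_of_le (by linarith [hx.2]),
      ← integral_Icc_eq_integral_Ioc, ← integral_indicator measurableSet_Icc]
    refine integral_congr_ae (.of_forall fun y => ?_)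
    have : (x, y) ∈ refTri ↔ y ∈ Set.Icc 0 (1 - x) := by
      constructor
      · rintro ⟨-, h2, h3⟩
        exact ⟨h2, by simp only at h3; linarith⟩
      · rintro ⟨h2, h3⟩
        exact ⟨hx.1, h2, by simp only; linarith⟩
    simp only [Set.indicator, this]
  · rw [Set.indicator_of_notMem hx]
    refine integral_eq_zero_of_ae (.of_forall fun y => ?_)
    refine Set.indicator_of_notMem ?_ _
    rintro ⟨h1, h2, h3⟩
    simp only at h1 h2 h3
    exact hx ⟨h1, by linarith⟩

theorem volume_refTri : volume.real refTri = 1 / 2 := by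
  have h := setIntegral_refTri (f := fun _ => 1) continuous_const
  rw [setIntegral_const] at h
  simp only [smul_eq_mul, mul_one] at h
  rw [h]
  simp only [intervalIntegral.integral_const, sub_zero, smul_eq_mul, mul_one]
  rw [intervalIntegral.integral_sub (by simp) (by simp)]
  norm_num [integral_id]

theorem setIntegral_refTri_fst : ∫ p in refTri, p.1 = 1 / 6 := by
  rw [setIntegral_refTri continuous_fst]
  have : ∀ x : ℝ, (∫ _ in (0 : ℝ)..(1 - x), x) = x - x ^ 2 := by
    intro x; simp; ring
  simp only [this]
  rw [intervalIntegral.integral_sub (by simp) (by simp)]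
  norm_num [integral_id]

theorem setIntegral_refTri_snd : ∫ p in refTri, p.2 = 1 / 6 := by
  rw [setIntegral_refTri continuous_snd]
  have : ∀ x : ℝ, (∫ y in (0 : ℝ)..(1 - x), y) = (1 / 2 - x) + x ^ 2 * 2⁻¹ := by
    intro x; rw [integral_id]; ring
  simp only [this]
  rw [intervalIntegral.integral_add (Continuous.intervalIntegrable (by fun_prop) _ _)
      (Continuous.intervalIntegrable (by fun_prop) _ _),
    intervalIntegral.integral_sub (by simp) (by simp)]
  norm_num [integral_id]

theorem setIntegral_refTri_bary (k : Fin 3) : ∫ p in refTri, bary p k = 1 / 6 := by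
  fin_cases k
  · show ∫ p in refTri, (1 - p.1 - p.2) = 1 / 6
    rw [integral_sub (Continuous.integrableOn_refTri (by fun_prop))
        (Continuous.integrableOn_refTri (by fun_prop)),
      integral_sub (Continuous.integrableOn_refTri (by fun_prop))
        (Continuous.integrableOn_refTri (by fun_prop)),
      setIntegral_refTri_fst, setIntegral_refTri_snd, setIntegral_const, volume_refTri]
    norm_num
  · exact setIntegral_refTri_fst
  · exact setIntegral_refTri_snd

theorem sum_bary (p : ℝ × ℝ) : ∑ k, bary p k = 1 := by
  simp [Fin.sum_univ_three, bary]
  ring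

theorem continuous_p1 (g : SubTri E → Fin 3 → ℝ) (T : SubTri E) : Continuous (p1 g T) :=
  continuous_finsetSum _ fun k _ => (continuous_bary k).mul continuous_const

theorem setIntegral_p1 (g : SubTri E → Fin 3 → ℝ) (T : SubTri E) :
    ∫ p in refTri, p1 g T p = (∑ k, g T k) / 6 := by
  unfold p1
  rw [integral_finsetSum _ fun k _ => Continuous.integrableOn_refTri
    ((continuous_bary k).fun_mul continuous_const)]
  simp only [integral_mul_const, setIntegral_refTri_bary]
  rw [← Finset.mul_sum]
  ring

theorem facetInt_const (T : SubTri E) (a : ℝ) : m.facetInt T (fun _ => a) = m.area T * a := by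
  rw [facetInt, setIntegral_const, volume_refTri, smul_eq_mul]
  ring

theorem continuous_rt0 (f : SubTri E → Fin 3 → ℝ) (T : SubTri E) : Continuous (m.rt0 f T) := by
  refine continuous_pi fun i => ?_
  simpa using m.continuous_rt0_dot (Pi.single i 1) f T

theorem continuous_perp {f : ℝ × ℝ → Fin 3 → ℝ} (hf : Continuous f) (T : SubTri E) :
    Continuous fun p => m.perp T (f p) := by
  refine continuous_pi fun i => ?_
  fin_cases i <;> simp [perp, cross_apply] <;> fun_prop

/-! ### Vector algebra on the facets -/

theorem two_mul_area (T : SubTri E) : 2 * m.area T = len3 (m.nvec T) := by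
  unfold area; ring

theorem gradBary_dot_edge (T : SubTri E) (k l : Fin 3) (hl : l ≠ k) :
    m.gradBary T k ⬝ᵥ (m.corner T k - m.corner T l) = 1 := by
  have hn := (len3_pos (m.nvec_ne T)).ne'
  have h2 := len3_sq (m.nvec T)
  -- By the scalar triple product this is the normal dotted with (side opposite `k`) × (edge from
  -- `l` to `k`), and that cross product is again the normal.
  have key : (m.nvec T ⨯₃ (m.corner T (k + 2) - m.corner T (k + 1))) ⬝ᵥ
      (m.corner T k - m.corner T l) = m.nvec T ⬝ᵥ m.nvec T := by
    generalize hN : m.nvec T = n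
    have e : ∀ a, n a = m.nvec T a := by rw [hN]; exact fun _ => rfl
    fin_cases k <;> fin_cases l <;> first | exact absurd rfl hl | skip
    all_goals
      simp [e, nvec, cross_apply, dotProduct, Fin.sum_univ_three]
      try ring
  rw [gradBary, smul_dotProduct, key, smul_eq_mul, ← h2, inv_mul_cancel₀ (pow_ne_zero 2 hn)]

theorem gradBary_dot_sub (T : SubTri E) (k l l' : Fin 3) :
    m.gradBary T k ⬝ᵥ (m.corner T l - m.corner T l') =
      (if l = k then 1 else 0) - (if l' = k then 1 else 0) := by
  by_cases h : l = k
  · by_cases h' : l' = k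
    · simp [h, h']
    · subst h; rw [gradBary_dot_edge _ _ _ _ h']; simp [h']
  · by_cases h' : l' = k
    · subst h'
      rw [← neg_sub, dotProduct_neg, gradBary_dot_edge _ _ _ _ h]; simp [h]
    · by_cases h0 : l = l'
      · simp [h0]
      -- The side opposite corner `k` is the difference of the two edges that end at `k`.
      · have e : m.corner T l - m.corner T l' = (m.corner T k - m.corner T l') -
          (m.corner T k - m.corner T l) := by abel
        rw [e, dotProduct_sub, gradBary_dot_edge _ _ _ _ h, gradBary_dot_edge _ _ _ _ h']
        simp [h, h']

theorem gradBary_dot_pt_sub (T : SubTri E) (k l : Fin 3) (p : ℝ × ℝ) :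
    m.gradBary T k ⬝ᵥ (m.pt T p - m.corner T l) = bary p k - (if l = k then 1 else 0) := by
  have e : m.pt T p - m.corner T l = ∑ a, bary p a • (m.corner T a - m.corner T l) := by
    simp only [smul_sub, Finset.sum_sub_distrib, pt]
    rw [← Finset.sum_smul, sum_bary, one_smul]
  rw [e, dotProduct_sum]
  simp only [dotProduct_smul, gradBary_dot_sub, smul_eq_mul, mul_sub, Finset.sum_sub_distrib]
  rw [← Finset.sum_mul, sum_bary]
  simp

theorem gradP1_dot_pt_sub (g : SubTri E → Fin 3 → ℝ) (T : SubTri E) (l : Fin 3) (p : ℝ × ℝ) :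
    m.gradP1 g T ⬝ᵥ (m.pt T p - m.corner T l) = p1 g T p - g T l := by
  simp only [gradP1, p1, sum_dotProduct, smul_dotProduct, gradBary_dot_pt_sub, smul_eq_mul, mul_sub,
    Finset.sum_sub_distrib]
  simp [mul_comm]

theorem gradP1_dot_rt0 (g f : SubTri E → Fin 3 → ℝ) (T : SubTri E) (p : ℝ × ℝ) :
    m.gradP1 g T ⬝ᵥ m.rt0 f T p = ∑ k, f T k / (2 * m.area T) * (p1 g T p - g T k) := by
  simp only [rt0, dotProduct_sum, dotProduct_smul, gradP1_dot_pt_sub, smul_eq_mul]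

theorem kvec_dot_gradBary (T : SubTri E) (k : Fin 3) : m.kvec T ⬝ᵥ m.gradBary T k = 0 := by
  rw [kvec, gradBary, smul_dotProduct, dotProduct_smul, dot_self_cross]
  simp

theorem kvec_dot_gradP1 (g : SubTri E → Fin 3 → ℝ) (T : SubTri E) :
    m.kvec T ⬝ᵥ m.gradP1 g T = 0 := by
  simp [gradP1, dotProduct_sum, kvec_dot_gradBary]

theorem kvec_dot_kvec (T : SubTri E) : m.kvec T ⬝ᵥ m.kvec T = 1 := by
  have hn := (len3_pos (m.nvec_ne T)).ne'
  rw [kvec, smul_dotProduct, dotProduct_smul, ← len3_sq, smul_eq_mul, smul_eq_mul]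
  field_simp
  rw [sq, orient_mul_self]

/-- Lagrange's identity for cross products. Tangency of one factor suffices; below that factor is
always a gradient. -/
theorem perp_dot_perp (T : SubTri E) {u : Fin 3 → ℝ} (hu : m.kvec T ⬝ᵥ u = 0) (w : Fin 3 → ℝ) :
    m.perp T u ⬝ᵥ m.perp T w = u ⬝ᵥ w := by
  rw [perp, perp, cross_dot_cross, kvec_dot_kvec, dotProduct_comm u (m.kvec T), hu]
  ring

/-- The flux of a rotated gradient through a side is the difference of the function between the ends
of that side, up to orientation. -/
theorem perp_gradP1 (g : SubTri E → Fin 3 → ℝ) (T : SubTri E) (p : ℝ × ℝ) :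
    m.perp T (m.gradP1 g T) =
      m.rt0 (fun T k => orient T * (g T (k + 1) - g T (k + 2))) T p := by
  have e : m.perp T (m.gradP1 g T) = ∑ k, g T k • m.perp T (m.gradBary T k) := by
    simp [perp, gradP1, map_sum]
  rw [e]
  simp only [perp_gradBary, rt0, ← two_mul_area, Fin.sum_univ_three, side]
  ext i
  simp
  ring

/-! ### Integration by parts -/

/-- Green's formula on one facet. The normal component of `rt0 f` is constant along each side, so
the boundary term is the flux times the mean of the two end values of `g`. -/
theorem facetInt_gradP1_dot_rt0 (g f : SubTri E → Fin 3 → ℝ) (T : SubTri E) :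
    m.facetInt T (fun p => m.gradP1 g T ⬝ᵥ m.rt0 f T p) +
      m.facetInt T (fun p => p1 g T p * m.divRT0 f T) =
    ∑ k, f T k * (g T (k + 1) + g T (k + 2)) / 2 := by
  have hA := (m.area_pos T).ne'
  simp only [facetInt, gradP1_dot_rt0]
  rw [integral_finsetSum _ fun k _ => Continuous.integrableOn_refTri (continuous_const.fun_mul
    ((continuous_p1 g T).fun_sub continuous_const)), integral_mul_const]
  simp only [integral_const_mul]
  have h : ∀ k, ∫ p in refTri, (p1 g T p - g T k) = (∑ l, g T l) / 6 - g T k / 2 := by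
    intro k
    rw [integral_sub (continuous_p1 g T).integrableOn_refTri
      continuous_const.integrableOn_refTri, setIntegral_p1, setIntegral_const, volume_refTri,
      smul_eq_mul]
    ring
  simp only [h, setIntegral_p1, divRT0, Fin.sum_univ_three]
  simp
  field_simp
  ring

/-! ### Cancellation across the sides of the supermesh -/

theorem sum_filter_eq_zero_of_antisymm {F κ : Type*} [Fintype F] [DecidableEq κ] {σ : F → F}
    (hσ : ∀ T, σ (σ T) = T) {elem : F → κ} (he : ∀ T, elem (σ T) = elem T) {u : F → ℝ}
    (hu : ∀ T, u (σ T) = -u T) (i : κ) : ∑ T with elem T = i, u T = 0 := by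
  have h : ∑ T with elem T = i, u T = ∑ T with elem T = i, u (σ T) :=
    Finset.sum_nbij' σ σ (by simp [he]) (by simp [he]) (by simp [hσ]) (by simp [hσ])
      (by simp [hσ])
  simp only [hu, Finset.sum_neg_distrib] at h
  linarith

theorem sum_eq_zero_of_antisymm {F : Type*} [Fintype F] {σ : F → F}
    (hσ : ∀ T, σ (σ T) = T) {u : F → ℝ} (hu : ∀ T, u (σ T) = -u T) : ∑ T, u T = 0 := by
  simpa using sum_filter_eq_zero_of_antisymm hσ (elem := fun _ => ()) (fun _ => rfl) hu ()

/-- Corner values of a continuous piecewise linear function: the values at the ends of a side agree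
on the two subtriangles that share it. -/
def IsContinuousP1 (g : SubTri E → Fin 3 → ℝ) : Prop :=
  ∀ k l T, l ≠ k → g (m.adj k T) l = g T l

/-- Each corner value depends only on the vertex, edge or cell at that corner, and crossing a side
keeps these for the two corners on it. -/
theorem isContinuousP1_hatVals [DecidableEq V] (j : V) (c : C → ℝ) :
    m.IsContinuousP1 (m.hatVals j c) := by
  intro k l T hl
  fin_cases k <;> fin_cases l <;> first | exact absurd rfl hl | skip
  · rfl
  · rfl
  · simp [hatVals, adj, vOf_turn]
  · simp [hatVals, adj, cOf_turn]
  · rfl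
  · rfl

theorem ne_add_one (k : Fin 3) : k + 1 ≠ k := by fin_cases k <;> decide

theorem ne_add_two (k : Fin 3) : k + 2 ≠ k := by fin_cases k <;> decide

theorem sum_eq_cyclic (u : Fin 3 → ℝ) (o : Fin 3) : ∑ k, u k = u o + u (o + 1) + u (o + 2) := by
  rw [Fin.sum_univ_three]; fin_cases o <;> simp <;> ring

/-- Summed over the closed surface, the boundary terms cancel in pairs: across a side the flux
changes sign while the end values of `g` agree. -/
theorem innerV_gradP1_rt0 [Fintype E] {g f : SubTri E → Fin 3 → ℝ} (hg : m.IsContinuousP1 g)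
    (hf : ∀ k T, f (m.adj k T) k = -f T k) :
    m.innerV (fun T _ => m.gradP1 g T) (m.rt0 f) =
      -m.innerS (p1 g) (fun T _ => m.divRT0 f T) := by
  rw [eq_neg_iff_add_eq_zero, innerV, innerS, intOver, intOver, ← Finset.sum_add_distrib]
  simp only [facetInt_gradP1_dot_rt0]
  rw [Finset.sum_comm]
  refine Finset.sum_eq_zero fun k _ => sum_eq_zero_of_antisymm (m.adj_adj k) fun T => ?_
  rw [hf, hg _ _ _ (ne_add_one k), hg _ _ _ (ne_add_two k)]
  ring

theorem innerV_sum_left [Fintype E] {ι : Type*} (S : Finset ι) (a : ι → ℝ)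
    {F : ι → SubTri E → ℝ × ℝ → Fin 3 → ℝ} {G : SubTri E → ℝ × ℝ → Fin 3 → ℝ}
    (hF : ∀ x T, Continuous (F x T)) (hG : ∀ T, Continuous (G T)) :
    m.innerV (fun T p => ∑ x ∈ S, a x • F x T p) G = ∑ x ∈ S, a x * m.innerV (F x) G := by
  have hc : ∀ x T, Continuous fun p => F x T p ⬝ᵥ G T p := fun x T => (hF x T).dotProduct (hG T)
  simp only [innerV, intOver, facetInt, sum_dotProduct, smul_dotProduct, smul_eq_mul,
    Finset.mul_sum]
  rw [Finset.sum_comm]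
  refine Finset.sum_congr rfl fun T _ => ?_
  rw [integral_finsetSum _ fun x _ => Continuous.integrableOn_refTri
    (continuous_const.fun_mul (hc x T)), Finset.mul_sum]
  refine Finset.sum_congr rfl fun x _ => ?_
  rw [integral_const_mul]
  ring

/-! ### Divergence and uniqueness of the compound Raviart-Thomas fields -/

namespace IsCompoundRT0

variable {m} [Fintype E] {κ : Type*} [DecidableEq κ] {o : Fin 3} {elem : SubTri E → κ}
  {b : SubTri E → ℝ} {f : SubTri E → Fin 3 → ℝ}

/-- The divergence theorem on a compound element: fluxes through its interior sides cancel in pairs.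
-/
theorem divRT0_eq (hf : m.IsCompoundRT0 o elem b f) (h1 : ∀ T, elem (m.adj (o + 1) T) = elem T)
    (h2 : ∀ T, elem (m.adj (o + 2) T) = elem T) (T : SubTri E) :
    m.divRT0 f T = (∑ S with elem S = elem T, b S) / ∑ S with elem S = elem T, m.area S := by
  have hA : 0 < ∑ S with elem S = elem T, m.area S :=
    Finset.sum_pos (fun S _ => m.area_pos S) ⟨T, by simp⟩
  have h : ∀ S ∈ ({S | elem S = elem T} : Finset (SubTri E)),
      m.divRT0 f T * m.area S = b S + f S (o + 1) + f S (o + 2) := by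
    intro S hS
    rw [← hf.div_const S T (Finset.mem_filter.1 hS).2, divRT0, div_mul_cancel₀ _ (m.area_pos S).ne',
      sum_eq_cyclic _ o, hf.boundary]
  rw [eq_div_iff hA.ne', Finset.mul_sum, Finset.sum_congr rfl h, Finset.sum_add_distrib,
    Finset.sum_add_distrib,
    sum_filter_eq_zero_of_antisymm (u := fun S => f S (o + 1)) (m.adj_adj (o + 1)) h1
      (hf.normal_cont (o + 1)),
    sum_filter_eq_zero_of_antisymm (u := fun S => f S (o + 2)) (m.adj_adj (o + 2)) h2
      (hf.normal_cont (o + 2)),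
    add_zero, add_zero]

/-- Without boundary flux the divergence vanishes, so what enters a facet from one neighbour in the
element leaves into the other: only a uniform circulation around the centre remains, and the weak
curl condition excludes it. -/
theorem eq_zero (hf : m.IsCompoundRT0 o elem 0 f) (h1 : ∀ T, elem (m.adj (o + 1) T) = elem T)
    (h2 : ∀ T, elem (m.adj (o + 2) T) = elem T)
    (hab : ∀ T T', elem T = elem T' →
      Relation.EqvGen (fun S S' => S' = m.adj (o + 1) S ∨ S' = m.adj (o + 2) S) T T') :
    f = 0 := by
  have hb : ∀ T, f T o = 0 := hf.boundary
  have hsum : ∀ T, f T (o + 2) = -f T (o + 1) := by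
    intro T
    have h := hf.divRT0_eq h1 h2 T
    simp only [Pi.zero_apply, Finset.sum_const_zero, zero_div] at h
    rw [divRT0, div_eq_zero_iff, or_iff_left (m.area_pos T).ne', sum_eq_cyclic _ o, hb] at h
    linarith
  -- The signed flux is the strength of the circulation, carried unchanged from facet to facet
  -- around the centre.
  have hgen : ∀ T T', Relation.EqvGen (fun S S' => S' = m.adj (o + 1) S ∨ S' = m.adj (o + 2) S)
      T T' → orient T * f T (o + 1) = orient T' * f T' (o + 1) := by
    intro T T' h
    induction h with
    | rel x y hxy =>
      rcases hxy with rfl | rfl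
      · rw [hf.normal_cont, orient_adj]; ring
      · have := hf.normal_cont (o + 2) x
        rw [hsum, hsum] at this
        rw [orient_adj]; linear_combination (-orient x) * this
    | refl x => rfl
    | symm x y _ ih => exact ih.symm
    | trans x y z _ _ ih1 ih2 => exact ih1.trans ih2
  have hz : ∀ T, f T (o + 1) = 0 := by
    intro T
    have hw := hf.weak_curl (elem T)
    -- On each facet the field is constant and parallel to the outer side, as is the rotated
    -- gradient it is tested with. All facets therefore contribute the same strength times a
    -- positive weight.
    have hterm : ∀ S ∈ ({S | elem S = elem T} : Finset (SubTri E)),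
        m.facetInt S (fun p => m.perp S (m.gradBary S o) ⬝ᵥ m.rt0 f S p) =
          -(orient T * f T (o + 1)) *
            (m.area S * ((m.side S o ⬝ᵥ m.side S o) / (len3 (m.nvec S) ^ 2))) := by
      intro S hS
      have hrt : ∀ p, m.rt0 f S p = (f S (o + 1) / (2 * m.area S)) • m.side S o := by
        intro p
        ext i
        simp only [rt0, Finset.sum_apply, Pi.smul_apply, Pi.sub_apply, smul_eq_mul, side]
        rw [sum_eq_cyclic _ o, hb, hsum]
        ring
      simp only [hrt, facetInt_const, perp_gradBary, smul_dotProduct, dotProduct_smul, smul_eq_mul,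
        two_mul_area]
      rw [← hgen S T (hab S T (Finset.mem_filter.1 hS).2)]
      ring
    rw [intOver, Finset.sum_congr rfl hterm, ← Finset.mul_sum] at hw
    have hpos : 0 < ∑ S with elem S = elem T,
        m.area S * ((m.side S o ⬝ᵥ m.side S o) / (len3 (m.nvec S) ^ 2)) :=
      Finset.sum_pos (fun S _ => mul_pos (m.area_pos S) (div_pos (m.side_dot_pos S o)
        (pow_pos (len3_pos (m.nvec_ne S)) 2))) ⟨T, by simp⟩
    have h0 := neg_eq_zero.1 ((mul_eq_zero.1 hw).resolve_right hpos.ne')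
    calc f T (o + 1) = orient T * (orient T * f T (o + 1)) := by
          rw [← mul_assoc, orient_mul_self, one_mul]
      _ = 0 := by rw [h0, mul_zero]
  funext T k
  have hk : k = o ∨ k = o + 1 ∨ k = o + 2 := by fin_cases o <;> fin_cases k <;> decide
  rcases hk with rfl | rfl | rfl
  · exact hb T
  · exact hz T
  · rw [hsum, hz, neg_zero]; rfl

end IsCompoundRT0

/-! ### Linear combinations of compound Raviart-Thomas fields -/

theorem rt0_add (f g : SubTri E → Fin 3 → ℝ) (T : SubTri E) (p : ℝ × ℝ) :
    m.rt0 (f + g) T p = m.rt0 f T p + m.rt0 g T p := by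
  simp only [rt0, Pi.add_apply, add_div, add_smul, Finset.sum_add_distrib]

theorem rt0_sum {ι : Type*} (S : Finset ι) (a : ι → ℝ) (f : ι → SubTri E → Fin 3 → ℝ)
    (T : SubTri E) (p : ℝ × ℝ) :
    m.rt0 (fun T k => ∑ x ∈ S, a x * f x T k) T p = ∑ x ∈ S, a x • m.rt0 (f x) T p := by
  simp only [rt0, Finset.smul_sum, smul_smul, Finset.sum_div, Finset.sum_smul]
  rw [Finset.sum_comm]
  simp only [mul_div_assoc]

namespace IsCompoundRT0

variable {m} [Fintype E] {κ : Type*} [DecidableEq κ] {o : Fin 3} {elem : SubTri E → κ}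

theorem add {b b' : SubTri E → ℝ} {f f' : SubTri E → Fin 3 → ℝ} (hf : m.IsCompoundRT0 o elem b f)
    (hf' : m.IsCompoundRT0 o elem b' f') : m.IsCompoundRT0 o elem (b + b') (f + f') where
  normal_cont k T := by simp only [Pi.add_apply, hf.normal_cont, hf'.normal_cont]; ring
  boundary T := by simp only [Pi.add_apply, hf.boundary, hf'.boundary]
  div_const T T' h := by
    have h1 := hf.div_const T T' h
    have h2 := hf'.div_const T T' h
    simp only [divRT0, Pi.add_apply, Finset.sum_add_distrib, add_div] at h1 h2 ⊢
    rw [h1, h2]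
  weak_curl i := by
    have h1 := hf.weak_curl i
    have h2 := hf'.weak_curl i
    simp only [intOver, facetInt, rt0_add, dotProduct_add] at h1 h2 ⊢
    -- The zero on the right is split so that each part can be replaced by one of the two vanishing
    -- integrals.
    rw [← add_zero (0 : ℝ)]
    nth_rewrite 1 [← h1]
    rw [← h2, ← Finset.sum_add_distrib]
    refine Finset.sum_congr rfl fun T _ => ?_
    rw [integral_add (m.continuous_rt0_dot _ _ T).integrableOn_refTri
      (m.continuous_rt0_dot _ _ T).integrableOn_refTri, mul_add]

theorem sum {ι : Type*} (S : Finset ι) (a : ι → ℝ) {b : ι → SubTri E → ℝ}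
    {f : ι → SubTri E → Fin 3 → ℝ} (hf : ∀ x, m.IsCompoundRT0 o elem (b x) (f x)) :
    m.IsCompoundRT0 o elem (fun T => ∑ x ∈ S, a x * b x T)
      (fun T k => ∑ x ∈ S, a x * f x T k) where
  normal_cont k T := by simp only [(hf _).normal_cont, mul_neg, Finset.sum_neg_distrib]
  boundary T := by simp only [(hf _).boundary]
  div_const T T' h := by
    have h1 : ∀ T, m.divRT0 (fun T k => ∑ x ∈ S, a x * f x T k) T =
        ∑ x ∈ S, a x * m.divRT0 (f x) T := by
      intro T
      simp only [divRT0]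
      rw [Finset.sum_comm, Finset.sum_div]
      simp only [← Finset.mul_sum, mul_div_assoc]
    rw [h1, h1]
    exact Finset.sum_congr rfl fun x _ => by rw [(hf x).div_const T T' h]
  weak_curl i := by
    simp only [intOver, facetInt, rt0_sum, dotProduct_sum, dotProduct_smul, smul_eq_mul]
    have h1 : ∀ T, ∫ p in refTri, ∑ x ∈ S, a x *
        (m.perp T (m.gradBary T o) ⬝ᵥ m.rt0 (f x) T p) =
        ∑ x ∈ S, a x * ∫ p in refTri, m.perp T (m.gradBary T o) ⬝ᵥ m.rt0 (f x) T p := by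
      intro T
      rw [integral_finsetSum _ fun x _ => Continuous.integrableOn_refTri
        (continuous_const.fun_mul (m.continuous_rt0_dot _ _ T))]
      simp only [integral_const_mul]
    simp only [h1, Finset.mul_sum]
    rw [Finset.sum_comm]
    refine Finset.sum_eq_zero fun x _ => ?_
    simp only [mul_left_comm _ (a x)]
    rw [← Finset.mul_sum]
    exact mul_eq_zero_of_right _ ((hf x).weak_curl i)

end IsCompoundRT0

/-! ### Incidence -/

theorem nInc_eq_sum [DecidableEq C] (e : E) (i : C) :
    m.nInc e i = ∑ l : Bool, if m.cell e l = i then bsign l else 0 := by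
  have h := m.cell_ne e
  by_cases h1 : m.cell e true = i
  · have h2 : m.cell e false ≠ i := fun h2 => h (h1.trans h2.symm)
    simp [nInc, h1, h2, bsign]
  · simp [nInc, h1, bsign]

theorem tInc_eq_sum [DecidableEq V] (e : E) (j : V) :
    m.tInc e j = ∑ h : Bool, if m.vert e h = j then bsign h else 0 := by
  have h := m.vert_ne e
  by_cases h1 : m.vert e true = j
  · have h2 : m.vert e false ≠ j := fun h2 => h (h1.trans h2.symm)
    simp [tInc, h1, h2, bsign]
  · simp [tInc, h1, bsign]

theorem orient_eq (e : E) (h l : Bool) : orient (e, h, l) = -(bsign h * bsign l) := by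
  cases h <;> cases l <;> simp [orient, bsign]

/-- The product n_{ei} t_{ej} is minus the sum of `orient` over the subtriangles of `e` in cell `i`
at vertex `j`. Over all edges these are paired by `turn`, which keeps cell and vertex and reverses
`orient`. -/
theorem D2_mul_D1 [Fintype E] [DecidableEq V] [DecidableEq C] : m.D2 * m.D1 = 0 := by
  ext i j
  have h : ∑ T : SubTri E, (if m.cellOf T = i then if m.vertOf T = j then orient T else 0 else 0)
      = 0 := by
    refine sum_eq_zero_of_antisymm m.turn_turn fun T => ?_
    rw [cOf_turn, vOf_turn, show orient (m.turn T) = -orient T from m.orient_adj 1 T]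
    split_ifs <;> simp
  rw [Matrix.zero_apply, ← neg_zero, ← h, Matrix.mul_apply, Fintype.sum_prod_type,
    ← Finset.sum_neg_distrib]
  refine Finset.sum_congr rfl fun e _ => ?_
  simp only [D2, D1, Matrix.of_apply, nInc_eq_sum, tInc_eq_sum, Finset.sum_mul_sum,
    Fintype.sum_prod_type, orient_eq, cellOf, vertOf]
  rw [Finset.sum_comm, ← Finset.sum_neg_distrib]
  refine Finset.sum_congr rfl fun h _ => ?_
  rw [← Finset.sum_neg_distrib]
  refine Finset.sum_congr rfl fun l _ => ?_
  split_ifs <;> ring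

theorem halfP_pos (e : E) (h : Bool) : 0 < m.halfP e h := by
  have := m.side_ne (e, h, true) 2
  refine len3_pos fun h0 => this ?_
  simpa [side, corner, vertOf, sub_eq_zero, eq_comm] using h0

theorem halfD_pos (e : E) (l : Bool) : 0 < m.halfD e l := by
  have := m.side_ne (e, true, l) 0
  refine len3_pos fun h0 => this ?_
  simpa [side, corner, cellOf] using h0

/-- On either side of `e` the two halves share the unit flux in proportion to their lengths, so the
fractions add up to 1. -/
theorem sum_vFlux [Fintype E] [DecidableEq E] [DecidableEq C] (e : E) (i : C) : ∑ T with m.cellOf T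
    = i, m.vFlux e T = m.nInc e i := by
  have hs : m.halfP e true + m.halfP e false ≠ 0 :=
    (add_pos (m.halfP_pos e true) (m.halfP_pos e false)).ne'
  rw [Finset.sum_filter, Fintype.sum_prod_type, Finset.sum_eq_single e (by
    intro e' _ he
    simp [vFlux, he]) (by simp), nInc_eq_sum]
  simp only [Fintype.sum_prod_type, vFlux, cellOf, if_true, Fintype.sum_bool]
  split_ifs <;> field_simp <;> ring

theorem sum_wFlux [Fintype E] [DecidableEq E] [DecidableEq V] (e : E) (j : V) : ∑ T with m.vertOf T
    = j, m.wFlux e T = m.tInc e j := by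
  have hs : m.halfD e true + m.halfD e false ≠ 0 :=
    (add_pos (m.halfD_pos e true) (m.halfD_pos e false)).ne'
  rw [Finset.sum_filter, Fintype.sum_prod_type, Finset.sum_eq_single e (by
    intro e' _ he
    simp [wFlux, he]) (by simp), tInc_eq_sum]
  simp only [Fintype.sum_prod_type, wFlux, vertOf, if_true, Fintype.sum_bool]
  split_ifs <;> field_simp <;> ring

/-! ### Divergences of the basis fields and rotated gradients of the hat functions -/

theorem exists_primal_rt0_spec [Fintype E] [DecidableEq E] [DecidableEq C] (e : E) :
    m.IsCompoundRT0 2 m.cellOf (m.vFlux e) (m.exists_primal_rt0 e).choose :=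
  (m.exists_primal_rt0 e).choose_spec

theorem exists_dual_rt0_spec [Fintype E] [DecidableEq E] [DecidableEq V] (e : E) :
    m.IsCompoundRT0 0 m.vertOf (m.wFlux e) (m.exists_dual_rt0 e).choose :=
  (m.exists_dual_rt0 e).choose_spec

theorem divRT0_primal [Fintype E] [Fintype C] [DecidableEq E] [DecidableEq C] (e : E)
    (T : SubTri E) (p : ℝ × ℝ) :
    m.divRT0 (m.exists_primal_rt0 e).choose T = ∑ i, m.nInc e i * m.alpha i T p := by
  rw [(m.exists_primal_rt0_spec e).divRT0_eq (fun _ => rfl) m.cOf_turn, sum_vFlux]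
  simp [alpha, cellTris, div_eq_mul_inv]

theorem divRT0_dual [Fintype V] [Fintype E] [DecidableEq V] [DecidableEq E] (e : E) (T : SubTri E)
    (p : ℝ × ℝ) :
    m.divRT0 (m.exists_dual_rt0 e).choose T = ∑ j, m.tInc e j * m.beta j T p := by
  rw [(m.exists_dual_rt0_spec e).divRT0_eq m.vOf_turn (fun _ => rfl), sum_wFlux]
  simp [beta, dualTris, div_eq_mul_inv]

/-- The rotated gradient of a discretely harmonic function is a compound Raviart-Thomas field. -/
theorem isCompoundRT0_perp_gradP1 [Fintype E] [DecidableEq C] {g : SubTri E → Fin 3 → ℝ}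
    (hc : m.IsContinuousP1 g)
    (hg : m.IsDiscreteHarmonic g) :
    m.IsCompoundRT0 2 m.cellOf (fun T => orient T * (g T 0 - g T 1))
      (fun T k => orient T * (g T (k + 1) - g T (k + 2))) where
  normal_cont k T := by
    rw [hc _ _ _ (ne_add_one k), hc _ _ _ (ne_add_two k), orient_adj]
    ring
  boundary T := rfl
  div_const T T' _ := by
    have h : ∀ T, m.divRT0 (fun T k => orient T * (g T (k + 1) - g T (k + 2))) T = 0 := by
      intro T
      simp only [divRT0, Fin.sum_univ_three]
      refine div_eq_zero_iff.2 (.inl ?_)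
      simp
      ring
    rw [h, h]
  weak_curl i := by
    -- Rotation by k preserves inner products of tangent vectors, which turns the weak curl
    -- condition into discrete harmonicity.
    simp only [← perp_gradP1]
    rw [← hg i]
    refine Finset.sum_congr rfl fun T _ => ?_
    simp only [perp_dot_perp _ _ (m.kvec_dot_gradBary T 2)]

/-- Equality of boundary fluxes. Linearity in arc length makes the change of the hat function over a
half edge equal, up to sign, to the fraction of the length in that half, which is also its share of
the flux. -/
theorem sum_tInc_mul_vFlux [Fintype E] [DecidableEq V] [DecidableEq E] (j : V) (c : C → ℝ)
    (T : SubTri E) :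
    ∑ e, m.tInc e j * m.vFlux e T =
      -(orient T * (m.hatVals j c T 0 - m.hatVals j c T 1)) := by
  obtain ⟨e, h, l⟩ := T
  have hs : m.halfP e true + m.halfP e false ≠ 0 :=
    (add_pos (m.halfP_pos e true) (m.halfP_pos e false)).ne'
  rw [Finset.sum_eq_single e (by
    intro e' _ he
    simp [vFlux, he.symm]) (by simp), tInc_eq_sum, orient_eq]
  simp only [vFlux, hatVals, vertOf, if_true, Fintype.sum_bool, Matrix.cons_val_zero,
    Matrix.cons_val_one]
  have hne := m.vert_ne e
  by_cases h1 : m.vert e true = j <;> by_cases h2 : m.vert e false = j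
  · exact absurd (h1.trans h2.symm) hne
  all_goals
    cases h <;> cases l <;> simp [h1, h2, bsign] <;> try field_simp
    all_goals try ring

/-- `∑ t_{ej} v_e = -k × ∇γ_j`. -/
theorem sum_tInc_smul_v [Fintype E] [DecidableEq V] [DecidableEq E] [DecidableEq C] (j : V)
    (T : SubTri E) (p : ℝ × ℝ) :
    ∑ e, m.tInc e j • m.v e T p =
      -m.perp T (m.gradP1 (m.hatVals j (m.exists_hat j).choose) T) := by
  -- The sum of the fields plus the rotated gradient is compound with zero boundary flux, hence zero
  -- by uniqueness.
  have h := (IsCompoundRT0.sum Finset.univ (fun e => m.tInc e j) m.exists_primal_rt0_spec).add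
    (m.isCompoundRT0_perp_gradP1 (m.isContinuousP1_hatVals j _) (m.exists_hat j).choose_spec)
  have hb : ((fun T => ∑ e, m.tInc e j * m.vFlux e T) + fun T => orient T *
      (m.hatVals j (m.exists_hat j).choose T 0 - m.hatVals j (m.exists_hat j).choose T 1)) =
      0 := by
    ext T
    simp [sum_tInc_mul_vFlux m j (m.exists_hat j).choose T]
  rw [hb] at h
  have h0 := congrArg (fun f => m.rt0 f T p) (h.eq_zero (fun _ => rfl) m.cOf_turn m.cell_cycle)
  simp only [rt0_add, rt0_sum, ← perp_gradP1] at h0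
  rw [eq_neg_iff_add_eq_zero]
  refine h0.trans ?_
  simp [rt0]

/-! ### Commutation identities between the mass matrices and the incidence matrices -/

/-- The left side is -⟨k × ∇γ_j, k × f⟩ = -⟨∇γ_j, f⟩, and integration by parts gives the rest. It
serves for both the primal and the dual fields. -/
theorem sum_tInc_mul_innerV_perp [Fintype E] [DecidableEq V] [DecidableEq E] [DecidableEq C]
    (j : V) {f : SubTri E → Fin 3 → ℝ}
    (hf : ∀ k T, f (m.adj k T) k = -f T k) :
    ∑ e, m.tInc e j * m.innerV (m.v e) (fun T p => m.perp T (m.rt0 f T p)) =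
      m.innerS (m.gamma j) (fun T _ => m.divRT0 f T) := by
  rw [← innerV_sum_left (F := m.v) _ _ _ (fun e T => m.continuous_rt0 _ T)
    (fun T => m.continuous_perp (m.continuous_rt0 f T) T)]
  simp only [sum_tInc_smul_v]
  have h := m.innerV_gradP1_rt0 (m.isContinuousP1_hatVals j (m.exists_hat j).choose) hf
  rw [gamma, ← neg_eq_iff_eq_neg.2 h]
  simp only [innerV, intOver, facetInt, neg_dotProduct, integral_neg, mul_neg,
    Finset.sum_neg_distrib, perp_dot_perp _ _ (m.kvec_dot_gradP1 _ _)]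

theorem innerS_sum_right [Fintype E] [DecidableEq V] [DecidableEq C] {ι : Type*} (S : Finset ι)
    (a : ι → ℝ) (j : V)
    (c : ι → SubTri E → ℝ) :
    m.innerS (m.gamma j) (fun T _ => ∑ x ∈ S, a x * c x T) =
      ∑ x ∈ S, m.innerS (m.gamma j) (fun T _ => c x T) * a x := by
  simp only [innerS, intOver, facetInt, integral_mul_const, Finset.sum_mul]
  rw [Finset.sum_comm]
  refine Finset.sum_congr rfl fun T _ => ?_
  rw [Finset.mul_sum, Finset.mul_sum]
  exact Finset.sum_congr rfl fun x _ => by ring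

theorem D2bar_mul_H [Fintype V] [Fintype E] [DecidableEq V] [DecidableEq E] [DecidableEq C] :
    m.D2bar * m.H = m.J * m.D2bar := by
  ext j e
  have h := m.sum_tInc_mul_innerV_perp j (m.exists_dual_rt0_spec e).normal_cont
  -- The point 0 is arbitrary, as `beta` is constant on each facet.
  simp only [divRT0_dual m e _ 0] at h
  rw [innerS_sum_right] at h
  exact h

theorem D2bar_mul_W [Fintype E] [Fintype C] [DecidableEq V] [DecidableEq E] [DecidableEq C] :
    m.D2bar * m.W = -(m.R * m.D2) := by
  ext j e
  have h := m.sum_tInc_mul_innerV_perp j (m.exists_primal_rt0_spec e).normal_cont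
  simp only [divRT0_primal m e _ 0] at h
  rw [innerS_sum_right] at h
  simp only [Matrix.mul_apply, Matrix.neg_apply, D2bar, D1, W, R, D2, Matrix.of_apply,
    Matrix.transpose_apply, mul_neg, Finset.sum_neg_distrib]
  exact congrArg Neg.neg h

theorem D2bar_mul_D1bar [Fintype E] [DecidableEq V] [DecidableEq C] : m.D2bar * m.D1bar = 0 := by
  rw [D2bar, D1bar, Matrix.mul_neg, ← Matrix.transpose_mul, D2_mul_D1, Matrix.transpose_zero,
    neg_zero]

/-! ### Integrals of dual fields -/

theorem intOver_dualTris_dualField [Fintype V] [Fintype E] [DecidableEq V] (X : V → ℝ) (j : V) :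
    m.intOver (m.dualTris j) (fun T p => m.dualField X T p) = X j := by
  -- A dual cell without facets would have total area 0, and the normalising factor would be 0⁻¹ =
  -- 0.
  obtain ⟨e, h, hj⟩ := m.vert_surj j
  have hA : 0 < ∑ S ∈ m.dualTris j, m.area S :=
    Finset.sum_pos (fun S _ => m.area_pos S)
      ⟨(e, h, true), Finset.mem_filter.2 ⟨Finset.mem_univ _, hj⟩⟩
  have hT : ∀ T ∈ m.dualTris j, m.facetInt T (fun p => m.dualField X T p) =
      m.area T * (X j * (∑ S ∈ m.dualTris j, m.area S)⁻¹) := by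
    intro T hT
    have : m.vertOf T = j := (Finset.mem_filter.1 hT).2
    subst this
    rw [← facetInt_const]
    simp [dualField, beta]
  rw [intOver, Finset.sum_congr rfl hT, ← Finset.sum_mul]
  field_simp

theorem dualField_add [Fintype V] [Fintype E] [DecidableEq V] (X Y : V → ℝ) (T : SubTri E)
    (p : ℝ × ℝ) :
    m.dualField (X + Y) T p = m.dualField X T p + m.dualField Y T p := by
  simp [dualField, add_mul, Finset.sum_add_distrib]

end PolygonalMesh

/-! ### Time derivatives and conclusion -/

theorem HasDerivWithinAt.mulVec {ι κ : Type*} [Fintype ι] [Fintype κ] (A : Matrix κ ι ℝ)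
    {x : ℝ → ι → ℝ} {x' : ι → ℝ} {I : Set ℝ} {t : ℝ} (hx : HasDerivWithinAt x x' I t) :
    HasDerivWithinAt (fun r => A *ᵥ x r) (A *ᵥ x') I t :=
  (LinearMap.toContinuousLinearMap A.mulVecLin).hasFDerivAt.comp_hasDerivWithinAt t hx

/-- Differentiation of the solution of a linear system with constant invertible matrix. -/
theorem HasDerivWithinAt.of_mulVec {ι : Type*} [Fintype ι] [DecidableEq ι] {A : Matrix ι ι ℝ}
    (hA : IsUnit A) {x b : ℝ → ι → ℝ} {y : ι → ℝ} {I : Set ℝ} {t : ℝ} (ht : t ∈ I)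
    (hb : HasDerivWithinAt b (A *ᵥ y) I t) (hx : ∀ r ∈ I, A *ᵥ x r = b r) :
    HasDerivWithinAt x y I t := by
  have hdet := (Matrix.isUnit_iff_isUnit_det A).1 hA
  have h := hb.mulVec A⁻¹
  have inv : ∀ z, A⁻¹ *ᵥ (A *ᵥ z) = z := by
    intro z
    rw [Matrix.mulVec_mulVec, Matrix.nonsing_inv_mul A hdet, Matrix.one_mulVec]
  rw [inv] at h
  -- On `I` the solution is A⁻¹ b, so its differentiability is a consequence and not an assumption.
  exact h.congr_of_mem (fun r hr => by rw [← hx r hr, inv]) ht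

theorem mainTheorem6 {V E C : Type*} [Fintype V] [Fintype E] [Fintype C]
    [DecidableEq V] [DecidableEq E] [DecidableEq C] (m : PolygonalMesh V E C) (hJ : IsUnit m.J)
    (adv1 : (E → ℝ) → (C → ℝ) → E → ℝ) (adv2 : (E → ℝ) → (V → ℝ) → E → ℝ)
    (PhiOrog : C → ℝ) (cor : V → ℝ) (I : Set ℝ) (s : SWTrajectory V E C)
    (hs : s.Solves m adv1 adv2 PhiOrog cor I) :
    ∀ t ∈ I,
      (∃ dPhiBar, HasDerivWithinAt s.PhiBar dPhiBar I t ∧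
        dPhiBar + m.D2bar *ᵥ s.FhatPerp t = 0) ∧
      (∃ dXiHat, HasDerivWithinAt s.XiHat dXiHat I t ∧
        dXiHat + m.D2bar *ᵥ s.QhatPerp t = 0) ∧
      (∀ j, HasDerivWithinAt
        (fun r => m.intOver (m.dualTris j) fun T p => m.dualField (s.PhiBar r) T p)
        (-∑ e, m.tInc e j * s.FhatPerp t e) I t) ∧
      (∀ j, HasDerivWithinAt
        (fun r => m.intOver (m.dualTris j) fun T p =>
          m.dualField (s.PV r) T p * m.dualField (s.PhiBar r) T p)
        (-∑ e, m.tInc e j * adv2 (s.FhatPerp t) (s.PV t) e) I t) := by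
  intro t ht
  have hPhiBar : HasDerivWithinAt s.PhiBar (-(m.D2bar *ᵥ s.FhatPerp t)) I t := by
    obtain ⟨dPhi, hd, heq⟩ := hs.mass t ht
    refine HasDerivWithinAt.of_mulVec hJ ht ?_ hs.dualMass
    have e : m.J *ᵥ -(m.D2bar *ᵥ s.FhatPerp t) = m.R *ᵥ dPhi := by
      rw [eq_neg_of_add_eq_zero_left heq, Matrix.mulVec_neg, Matrix.mulVec_neg,
        Matrix.mulVec_mulVec, ← m.D2bar_mul_H, ← Matrix.mulVec_mulVec, hs.dualMassFlux t ht,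
        Matrix.mulVec_neg, Matrix.mulVec_mulVec, m.D2bar_mul_W, Matrix.neg_mulVec,
        Matrix.mulVec_mulVec, neg_neg]
    rw [e]
    exact hd.mulVec m.R
  have hXiHat : HasDerivWithinAt s.XiHat (-(m.D2bar *ᵥ s.QhatPerp t)) I t := by
    obtain ⟨dU, hd, heq⟩ := hs.momentum t ht
    refine HasDerivWithinAt.of_mulVec hJ ht ?_
      -- Eliminating N Ξ leaves J Ξ̂ = D̄₂ M U.
      (fun r hr => (hs.dualVorticity r hr).trans (hs.vorticity r hr))
    have e : m.J *ᵥ -(m.D2bar *ᵥ s.QhatPerp t) = m.D2bar *ᵥ (m.M *ᵥ dU) := by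
      -- The discrete curl of the momentum equation, in which the gradient term drops out.
      have h := congrArg (m.D2bar *ᵥ ·) heq
      simp only [Matrix.mulVec_add, Matrix.mulVec_zero] at h
      rw [← hs.primalPVFlux t ht] at h
      simp only [Matrix.mulVec_mulVec, ← Matrix.mul_assoc, m.D2bar_mul_D1bar, Matrix.zero_mul,
        Matrix.zero_mulVec, add_zero, m.D2bar_mul_H] at h
      rw [Matrix.mulVec_neg, Matrix.mulVec_mulVec, Matrix.mulVec_mulVec]
      exact (eq_neg_of_add_eq_zero_left h).symm
    rw [e]
    exact (hd.mulVec m.M).mulVec m.D2bar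
  refine ⟨⟨_, hPhiBar, neg_add_cancel _⟩, ⟨_, hXiHat, neg_add_cancel _⟩, fun j => ?_, fun j => ?_⟩
  · simp only [m.intOver_dualTris_dualField]
    exact hasDerivWithinAt_pi.1 hPhiBar j
  · rw [← hs.pvFlux t ht]
    -- On dual cell `j` the integral of π φ̄ is f_j + Ξ̂_j, and f_j does not depend on time.
    refine ((hasDerivWithinAt_pi.1 hXiHat j).const_add (cor j)).congr_of_mem (fun r hr => ?_) ht
    simp only [hs.pv r hr, ← m.dualField_add, m.intOver_dualTris_dualField, Pi.add_apply]
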